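/- Fix a set $S$ of unary relation symbols. A Kripke model consists of a set $A$ with a binary relation $\succ$, a subset $\mathscr P^A\subseteq A$ for each $\mathscr P\in S$, and a distinguished element $a\in A$. Homomorphisms are the functions preserving $\succ$, each $\mathscr P$ and the distinguished element; a homomorphism is a pathwise embedding if it also reflects each $\mathscr P$, and an embedding if it is injective and reflects both $\succ$ and each $\mathscr P$. A synchronization tree is a Kripke model in which for every element $x$ there is a unique finite sequence $c_0\succ\cdots\succ c_n=x$ starting at the distinguished element $c_0$. A path is a synchronization tree whose tree order (the reflexive transitive closure of $\succ$) is a finite chain. For an ordinal $k\le\omega$, let $\mathbf P_k$ be the category whose objects are the paths with at most $k$ elements (in a small skeleton: those with universe $\{0,\dots,n-1\}$, $n\ge 1$, distinguished element $0$ and $i\succ j$ iff $i+1=j$) and whose morphisms are the pathwise embeddings. Let $\widehat{\mathbf P_k}=[\mathbf P_k^{\mathrm{op}},\mathbf{Set}]$, and regard paths as objects of $\widehat{\mathbf P_k}$ via the Yoneda embedding. Let $\Pi$ be the set of all embeddings between paths, let $\varnothing$ be the initial presheaf, and let $\Pi_\varnothing$ be the set $\Pi$ together with the unique arrows $\varnothing\to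 P$ for all $P\in\mathbf P_k$ (the "empty path" $\varnothing$ being allowed as a domain). For a class $M$ of arrows, ${}^{\pitchfork}M$ and $M^{\pitchfork}$ denote the classes of arrows having the left, respectively right, lifting property with respect to all arrows in $M$. **Proposition.** For every $k\le\omega$, the category $\widehat{\mathbf P_k}$ admits a (Quillen) model structure such that: (i) the cofibrations are precisely the monomorphisms, and they coincide with the class ${}^{\pitchfork}(\Pi_\varnothing^{\pitchfork})$; (ii) a presheaf $X\in\widehat{\mathbf P_k}$ is fibrant if and only if, for all arrows $i\colon P\to Q$ in $\Pi$, if there exists an arrow $Q\to X$ in $\widehat{\mathbf P_k}$, then for every arrow $f\colon P\to X$ there is an arrow $g\colon Q\to X$ with $g\circ i=f$. -/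

import Mathlib

open CategoryTheory CategoryTheory.Limits HomotopicalAlgebra

universe u v

/-! ### Kripke models over a set `S` of unary relation symbols -/

/-- A (pointed) Kripke model for the modal vocabulary `S`: a set with an accessibility relation,
a subset for each unary relation symbol, and a distinguished element. -/
structure KripkeModel (S : Type u) where
  carrier : Type v
  acc : carrier → carrier → Prop
  rel : S → Set carrier
  point : carrier

namespace KripkeModel

variable {S : Type u}

/-- Homomorphisms of Kripke models. -/
@[ext]
structure Hom (A B : KripkeModel.{u, v} S) where
  toFun : A.carrier → B.carrier
  map_acc : ∀ x y, A.acc x y → B.acc (toFun x) (toFun y)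
  map_rel : ∀ s x, x ∈ A.rel s → toFun x ∈ B.rel s
  map_point : toFun A.point = B.point

/-- A pathwise embedding is a homomorphism that reflects the unary relations. -/
def Hom.IsPathwiseEmbedding {A B : KripkeModel.{u, v} S} (f : Hom A B) : Prop :=
  ∀ s x, f.toFun x ∈ B.rel s → x ∈ A.rel s

/-- An embedding is an injective homomorphism that reflects both the unary relations and the
accessibility relation. -/
def Hom.IsEmbedding {A B : KripkeModel.{u, v} S} (f : Hom A B) : Prop :=
  Function.Injective f.toFun ∧ (∀ s x, f.toFun x ∈ B.rel s → x ∈ A.rel s) ∧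
    ∀ x y, B.acc (f.toFun x) (f.toFun y) → A.acc x y

/-- `A.IsBranch l x`: the finite sequence `l = [c₀, …, cₙ]` satisfies `c₀ ≻ ⋯ ≻ cₙ` (where `≻` is
the accessibility relation), starts at the distinguished element, and ends at `x`. -/
def IsBranch (A : KripkeModel.{u, v} S) (l : List A.carrier) (x : A.carrier) : Prop :=
  l.IsChain A.acc ∧ l.head? = some A.point ∧ l.getLast? = some x

/-- A synchronization tree: every element is reached from the distinguished element by a unique
finite sequence of accessibility steps. -/
def IsSyncTree (A : KripkeModel.{u, v} S) : Prop :=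
  ∀ x : A.carrier, ∃! l : List A.carrier, A.IsBranch l x

/-- The height is at most `k`: each branch starting at the root has at most `k` elements. -/
def HeightLE (A : KripkeModel.{u, v} S) (k : ℕ∞) : Prop :=
  ∀ (l : List A.carrier) (x : A.carrier), A.IsBranch l x → (l.length : ℕ∞) ≤ k

/-- The tree order (the reflexive transitive closure of the accessibility relation) is a finite
chain. -/
def IsFiniteChain (A : KripkeModel.{u, v} S) : Prop :=
  Finite A.carrier ∧
    ∀ x y : A.carrier, Relation.ReflTransGen A.acc x y ∨ Relation.ReflTransGen A.acc y x

end KripkeModel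

/-! ### The category of synchronization trees of height at most `k` and pathwise embeddings -/

/-- Synchronization trees of height at most `k`, for `k` a natural number or `⊤` (that is, `ω`). -/
structure SyncTree (S : Type u) (k : ℕ∞) where
  model : KripkeModel.{u, v} S
  isSyncTree : model.IsSyncTree
  heightLE : model.HeightLE k

namespace SyncTree

variable {S : Type u} {k : ℕ∞}

/-- The morphisms of the category of synchronization trees: pathwise embeddings. -/
@[ext]
structure Hom (A B : SyncTree.{u, v} S k) where
  hom : KripkeModel.Hom A.model B.model
  isPathwiseEmbedding : hom.IsPathwiseEmbedding

instance : Category.{v} (SyncTree.{u, v} S k) where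
  Hom A B := Hom A B
  id A :=
    { hom :=
        { toFun := fun x => x
          map_acc := fun _ _ h => h
          map_rel := fun _ _ h => h
          map_point := rfl }
      isPathwiseEmbedding := fun _ _ h => h }
  comp f g :=
    { hom :=
        { toFun := fun x => g.hom.toFun (f.hom.toFun x)
          map_acc := fun _ _ h => g.hom.map_acc _ _ (f.hom.map_acc _ _ h)
          map_rel := fun _ _ h => g.hom.map_rel _ _ (f.hom.map_rel _ _ h)
          map_point := by rw [f.hom.map_point, g.hom.map_point] }
      isPathwiseEmbedding := fun _ _ h =>
        f.isPathwiseEmbedding _ _ (g.isPathwiseEmbedding _ _ h) }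

end SyncTree

/-! ### Paths -/

/-- Data of a path with universe `{0, …, length - 1}` having at most `k` elements: its length and
the interpretation of the unary relation symbols. -/
structure PathData (S : Type u) (k : ℕ∞) where
  length : ℕ
  length_pos : 0 < length
  length_le : (length : ℕ∞) ≤ k
  label : S → Set (Fin length)

namespace PathData

variable {S : Type u} {k : ℕ∞}

/-- The Kripke model `0 ≻ 1 ≻ ⋯ ≻ length - 1` with distinguished element `0`. -/
def model (P : PathData S k) : KripkeModel.{u, 0} S where
  carrier := Fin P.length
  acc i j := (i : ℕ) + 1 = j
  rel := P.label
  point := ⟨0, P.length_pos⟩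

/-- The sequence `0, 1, …, x` is the unique branch ending at `x`. -/
theorem branch_unique {n : ℕ} (hn : 0 < n) (x : Fin n) (l : List (Fin n)) :
    (l.IsChain (fun i j : Fin n => (i : ℕ) + 1 = j) ∧ l.head? = some ⟨0, hn⟩ ∧
      l.getLast? = some x) ↔ l = (List.finRange n).take ((x : ℕ) + 1) := by
  have hx := x.isLt
  constructor
  · rintro ⟨hc, hh, hl⟩
    have hi : ∀ (i : ℕ) (hi : i < l.length), (l[i] : ℕ) = i := by
      intro i hi
      induction i with
      | zero =>
        rw [List.head?_eq_getElem?, List.getElem?_eq_getElem hi, Option.some_inj] at hh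
        rw [hh]
      | succ i ih =>
        rw [← List.isChain_iff_getElem.1 hc i hi, ih]
    have hne : l ≠ [] := by rintro rfl; simp at hl
    have hpos : 0 < l.length := List.length_pos_of_ne_nil hne
    have hlt : l.length - 1 < l.length := by omega
    rw [List.getLast?_eq_getElem?, List.getElem?_eq_getElem hlt, Option.some_inj] at hl
    have h2 := hi _ hlt
    rw [hl] at h2
    refine List.ext_getElem ?_ ?_
    · simp; omega
    · intro i h1 _
      refine Fin.ext ?_
      rw [hi i h1]
      simp
  · rintro rfl
    refine ⟨?_, ?_, ?_⟩
    · rw [List.isChain_iff_getElem]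
      intro i hi
      simp
    · simp [List.head?_eq_getElem?]
    · have hlen : ((List.finRange n).take ((x : ℕ) + 1)).length = (x : ℕ) + 1 := by
        simp
      rw [List.getLast?_eq_getElem?, hlen]
      simp [hx]

theorem isSyncTree (P : PathData S k) : P.model.IsSyncTree := fun x =>
  ⟨_, (branch_unique P.length_pos x _).2 rfl, fun l hl => (branch_unique P.length_pos x l).1 hl⟩

theorem heightLE (P : PathData S k) : P.model.HeightLE k := by
  intro l x hl
  refine le_trans ?_ P.length_le
  have h : l = _ := (branch_unique P.length_pos x l).1 hl
  rw [h]
  exact_mod_cast (by simp : ((List.finRange P.length).take _).length ≤ P.length)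

theorem isFiniteChain (P : PathData S k) : P.model.IsFiniteChain := by
  have key : ∀ (d : ℕ) (i j : Fin P.length), (i : ℕ) + d = j →
      Relation.ReflTransGen P.model.acc i j := by
    intro d
    induction d with
    | zero =>
      intro i j h
      obtain rfl : i = j := Fin.ext h
      exact Relation.ReflTransGen.refl
    | succ d ih =>
      intro i j h
      have hj := j.isLt
      exact (ih i ⟨(i : ℕ) + d, by omega⟩ rfl).tail (show (i : ℕ) + d + 1 = j by omega)
  refine ⟨inferInstanceAs (Finite (Fin P.length)), fun i j => ?_⟩
  rcases le_total (α := Fin P.length) i j with h | h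
  · exact Or.inl (key _ i j (Nat.add_sub_of_le h))
  · exact Or.inr (key _ j i (Nat.add_sub_of_le h))

/-- A path as a synchronization tree of height at most `k`. -/
def toSyncTree (P : PathData S k) : SyncTree.{u, 0} S k where
  model := P.model
  isSyncTree := P.isSyncTree
  heightLE := P.heightLE

end PathData

/-- The category `P_k`: the (small) full subcategory of the category of synchronization trees of
height at most `k` and pathwise embeddings, whose objects are the paths in the standard skeleton. -/
abbrev PathCat (S : Type u) (k : ℕ∞) : Type u :=
  InducedCategory (SyncTree.{u, 0} S k) (PathData.toSyncTree (S := S) (k := k))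

/-- The presheaf category on `P_k`. -/
abbrev PathPresheaf (S : Type u) (k : ℕ∞) : Type (u + 1) :=
  (PathCat S k)ᵒᵖ ⥤ Type u

/-- A path regarded as a (representable) presheaf. -/
noncomputable abbrev PathCat.rep {S : Type u} {k : ℕ∞} :
    PathCat S k ⥤ PathPresheaf S k :=
  uliftYoneda.{u}

/-- A morphism between paths is an embedding if the underlying homomorphism of Kripke models is. -/
def PathCat.IsEmbedding {S : Type u} {k : ℕ∞} {P Q : PathCat S k} (i : P ⟶ Q) : Prop :=
  i.hom.hom.IsEmbedding

/-- The set `Π` of all embeddings between paths, as arrows of the presheaf category. -/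
inductive pathEmbeddings (S : Type u) (k : ℕ∞) : MorphismProperty (PathPresheaf S k)
  | mk {P Q : PathCat S k} (i : P ⟶ Q) (hi : PathCat.IsEmbedding i) :
      pathEmbeddings S k (PathCat.rep.map i)

/-- The set of all arrows from the initial (empty) presheaf to a path. -/
inductive emptyToPath (S : Type u) (k : ℕ∞) : MorphismProperty (PathPresheaf S k)
  | mk (P : PathCat S k) : emptyToPath S k (initial.to (PathCat.rep.obj P))

/-! Cofibrations are the monomorphisms, and weak equivalences are the maps `X ⟶ Y` whose source and
target are inhabited at the same objects. This gives a model structure on any category of functors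
to types. Injective hulls factor maps as a monomorphism followed by a map in the right class of the
monomorphisms. Restricting the target to the support of the source gives the other factorization,
and the retract argument identifies the trivial fibrations (`rlp_inf_supportEquivalences`).

What is special to paths is that `PathCat` is a forest order by initial segments. Lifting against Π
and the empty inclusions is therefore enough to lift against every monomorphism, by recursion on
path length (`IsPathSurjective.hasLiftingProperty`). For fibrancy, `X` is compared with its support,
the subterminal presheaf inhabited exactly where `X` is: the stated extension condition says that `X
⟶ support X` is a trivial fibration. -/

namespace FunctorToTypes

/-! ### Supports and the weak equivalences they define -/

section Support

universe w v₁ u₁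

variable {D : Type u₁} [Category.{v₁} D]

/-- The natural transformations `X ⟶ Y` such that `X` is inhabited wherever `Y` is. -/
def supportEquivalences (D : Type u₁) [Category.{v₁} D] : MorphismProperty (D ⥤ Type w) :=
  fun X Y _ => ∀ d, Nonempty (Y.obj d) → Nonempty (X.obj d)

instance : (supportEquivalences.{w} D).HasTwoOutOfThreeProperty where
  comp_mem _ _ hf hg d hd := hf d (hg d hd)
  of_postcomp _ g _ hfg d hd := hfg d (hd.map (g.app d))
  of_precomp f _ _ hfg d hd := (hfg d hd).map (f.app d)

instance : (supportEquivalences.{w} D).IsStableUnderRetracts where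
  of_retract h hg d hd := (hg d (hd.map (h.i.right.app d))).map (h.r.left.app d)

theorem mono_iff_injective {X Y : D ⥤ Type w} (f : X ⟶ Y) :
    Mono f ↔ ∀ d, Function.Injective (f.app d) := by
  simp_rw [NatTrans.mono_iff_mono_app, CategoryTheory.mono_iff_injective]

/-- The part of `Y` lying over the support of `X`. -/
def supportSubfunctor (X Y : D ⥤ Type w) : Subfunctor Y where
  obj d := {_y | Nonempty (X.obj d)}
  map g _ hx := hx.map (X.map g)

/-- If `B` is inhabited only where `A` is, a square forces `B ⟶ Y` to land over the support of `X`.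
-/
theorem supportSubfunctor_ι_mem_rlp (X Y : D ⥤ Type w) :
    (MorphismProperty.monomorphisms (D ⥤ Type w) ⊓ supportEquivalences D).rlp
      (supportSubfunctor X Y).ι := by
  intro A B i hi
  refine ⟨fun {u v} sq => ?_⟩
  have hv : Subfunctor.range v ≤ supportSubfunctor X Y := fun d _ hy => by
    obtain ⟨b, -⟩ := hy
    obtain ⟨a⟩ := hi.2 d ⟨b⟩
    exact (u.app d a).2
  refine ⟨⟨⟨Subfunctor.lift v hv, ?_, Subfunctor.lift_ι v hv⟩⟩⟩
  rw [← cancel_mono (supportSubfunctor X Y).ι, Category.assoc, Subfunctor.lift_ι, sq.w]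

/-- The subterminal functor that is inhabited wherever `X` is. -/
def support (X : D ⥤ Type w) : D ⥤ Type w where
  obj d := {_x : PUnit.{w + 1} // Nonempty (X.obj d)}
  map g := ↾fun x => ⟨x.1, x.2.map (X.map g)⟩

instance (X : D ⥤ Type w) (d : D) : Subsingleton ((support X).obj d) :=
  inferInstanceAs (Subsingleton {_x : PUnit // Nonempty (X.obj d)})

/-- The morphism to a support given by an inclusion of supports. -/
def homSupport {X Y : D ⥤ Type w} (h : ∀ d, Nonempty (Y.obj d) → Nonempty (X.obj d)) :
    Y ⟶ support X where
  app d := ↾fun y => ⟨PUnit.unit, h d ⟨y⟩⟩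

theorem hom_support_ext {X Y : D ⥤ Type w} (f g : Y ⟶ support X) : f = g := by
  ext d y
  exact Subsingleton.elim (f.app d y) (g.app d y)

end Support

/-! ### Injective functors, factorizations and the model structure -/

section Cofree

universe v₁ u₁

variable {D : Type u₁} [Category.{v₁} D]

/-- The functor cofreely generated by a family of types. -/
def cofree (T : D → Type (max u₁ v₁)) : D ⥤ Type (max u₁ v₁) where
  obj d := ∀ c, (d ⟶ c) → T c
  map g := ↾fun t c h => t c (g ≫ h)

-- A map into `cofree T` amounts to an arbitrary family of functions into the `T c`, so it extends
-- along a monomorphism pointwise, with any default value off the image.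
open Classical in
instance injective_cofree (T : D → Type (max u₁ v₁)) [∀ c, Nonempty (T c)] :
    Injective (cofree T) where
  factors {A B} g i _ := by
    have hi := (mono_iff_injective i).1 inferInstance
    refine ⟨{ app := fun d => ↾fun b c h =>
                if hb : ∃ a, i.app c a = B.map h b then g.app c hb.choose c (𝟙 c)
                else Classical.arbitrary _
              naturality := ?_ }, ?_⟩
    · intro d e h
      ext b
      funext c k
      simp [cofree]
    · ext d a
      funext c h
      have ha : ∃ a', i.app c a' = B.map h (i.app d a) :=
        ⟨A.map h a, NatTrans.naturality_apply i h a⟩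
      have hc : ha.choose = A.map h a :=
        hi c (ha.choose_spec.trans (NatTrans.naturality_apply i h a).symm)
      have hg : g.app c (A.map h a) = (cofree T).map h (g.app d a) :=
        NatTrans.naturality_apply g h a
      change (if hb : ∃ a', i.app c a' = B.map h (i.app d a) then g.app c hb.choose c (𝟙 c)
        else _) = g.app d a c h
      rw [dif_pos ha, hc, hg]
      exact congrArg (g.app d a c) (Category.comp_id h)

/-- The canonical map of a functor to an injective one. -/
def toCofree (X : D ⥤ Type (max u₁ v₁)) : X ⟶ cofree fun c => Option (X.obj c) where
  app d := ↾fun x c h => some (X.map h x)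
  naturality d e h := by
    ext x
    funext c k
    simp [cofree]

instance (X : D ⥤ Type (max u₁ v₁)) : Mono (toCofree X) := by
  rw [mono_iff_injective]
  intro d x y h
  have h' : some (X.map (𝟙 d) x) = some (X.map (𝟙 d) y) := congrFun (congrFun h d) (𝟙 d)
  simpa using h'

variable (D)

instance hasFactorization_monomorphisms_rlp :
    (MorphismProperty.monomorphisms (D ⥤ Type (max u₁ v₁))).HasFactorization
      (MorphismProperty.monomorphisms (D ⥤ Type (max u₁ v₁))).rlp where
  nonempty_mapFactorizationData {X Y} f := ⟨
    -- `Option` provides the default values that make the second factor injective even where `X` is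
    -- empty.
    { Z := Y ⨯ cofree fun c => Option (X.obj c)
      i := prod.lift f (toCofree X)
      p := prod.fst
      fac := prod.lift_fst _ _
      hi := mono_of_mono_fac (prod.lift_snd f (toCofree X))
      hp := fun A B i hi => by
        have : Mono i := hi
        refine ⟨fun {u v} sq => ⟨⟨⟨prod.lift v (Injective.factorThru (u ≫ prod.snd) i),
          ?_, prod.lift_fst _ _⟩⟩⟩⟩
        apply Limits.prod.hom_ext
        · rw [Category.assoc, prod.lift_fst, sq.w]
        · rw [Category.assoc, prod.lift_snd, Injective.comp_factorThru] }⟩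

instance hasFactorization_supportEquivalences_rlp :
    (MorphismProperty.monomorphisms (D ⥤ Type (max u₁ v₁)) ⊓ supportEquivalences D).HasFactorization
      (MorphismProperty.monomorphisms (D ⥤ Type (max u₁ v₁)) ⊓ supportEquivalences D).rlp where
  nonempty_mapFactorizationData {X Y} f := by
    have hf : Subfunctor.range f ≤ supportSubfunctor X Y := fun d _ hy => by
      obtain ⟨x, -⟩ := hy
      exact ⟨x⟩
    let φ := MorphismProperty.factorizationData (MorphismProperty.monomorphisms _)
      (MorphismProperty.monomorphisms _).rlp (Subfunctor.lift f hf)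
    exact ⟨
      { Z := φ.Z
        i := φ.i
        p := φ.p ≫ (supportSubfunctor X Y).ι
        fac := by rw [φ.fac_assoc, Subfunctor.lift_ι]
        -- `φ.Z` maps to the part of `Y` over the support of `X`, so it is inhabited only there.
        hi := ⟨φ.hi, fun d ⟨z⟩ => (φ.p.app d z).2⟩
        hp := MorphismProperty.comp_mem _ _ _
          (MorphismProperty.antitone_rlp inf_le_left _ φ.hp)
          (supportSubfunctor_ι_mem_rlp X Y) }⟩

/-- Lifting the identity of `Y` along the inclusion of the empty subfunctor gives a section of `f`.
-/
theorem monomorphisms_rlp_le_supportEquivalences :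
    (MorphismProperty.monomorphisms (D ⥤ Type (max u₁ v₁))).rlp ≤ supportEquivalences D := by
  intro X Y f hf d ⟨y⟩
  have := hf (⊥ : Subfunctor Y).ι (inferInstanceAs (Mono _))
  let u : (⊥ : Subfunctor Y).toFunctor ⟶ X :=
    { app d := ↾fun z => z.2.elim
      naturality _ _ _ := by ext z; exact z.2.elim }
  have sq : CommSq u (⊥ : Subfunctor Y).ι f (𝟙 Y) := ⟨by ext d z; exact z.2.elim⟩
  exact ⟨sq.lift.app d y⟩

/-- Retract argument: in a factorization of `f` as a monomorphism and a map in the right class,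
two-out-of-three makes the monomorphism a weak equivalence. So `f` lifts against it and is a retract
of the second factor. -/
theorem rlp_inf_supportEquivalences :
    (MorphismProperty.monomorphisms (D ⥤ Type (max u₁ v₁)) ⊓ supportEquivalences D).rlp ⊓
      supportEquivalences D = (MorphismProperty.monomorphisms (D ⥤ Type (max u₁ v₁))).rlp := by
  refine le_antisymm (fun X Y f hf => ?_) (le_inf (MorphismProperty.antitone_rlp inf_le_left)
    (monomorphisms_rlp_le_supportEquivalences D))
  let φ := MorphismProperty.factorizationData (MorphismProperty.monomorphisms _)
    (MorphismProperty.monomorphisms _).rlp f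
  have hi : supportEquivalences D φ.i :=
    MorphismProperty.of_postcomp _ _ φ.p (monomorphisms_rlp_le_supportEquivalences D _ φ.hp)
      (by rw [φ.fac]; exact hf.2)
  have := hf.1 φ.i ⟨φ.hi, hi⟩
  exact MorphismProperty.of_retract (RetractArrow.ofRightLiftingProperty φ.fac) φ.hp

theorem isWeakFactorizationSystem_monomorphisms :
    MorphismProperty.IsWeakFactorizationSystem
      (MorphismProperty.monomorphisms (D ⥤ Type (max u₁ v₁)))
      (MorphismProperty.monomorphisms (D ⥤ Type (max u₁ v₁))).rlp where
  rlp := rfl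
  llp := MorphismProperty.llp_eq_of_le_llp_of_hasFactorization_of_isStableUnderRetracts
    (MorphismProperty.le_llp_rlp _)

theorem isWeakFactorizationSystem_supportEquivalences :
    MorphismProperty.IsWeakFactorizationSystem
      (MorphismProperty.monomorphisms (D ⥤ Type (max u₁ v₁)) ⊓ supportEquivalences D)
      (MorphismProperty.monomorphisms (D ⥤ Type (max u₁ v₁)) ⊓ supportEquivalences D).rlp where
  rlp := rfl
  llp := MorphismProperty.llp_eq_of_le_llp_of_hasFactorization_of_isStableUnderRetracts
    (MorphismProperty.le_llp_rlp _)

/-- The model structure whose cofibrations are the monomorphisms and whose weak equivalences are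
the morphisms that do not change the support. -/
abbrev supportModelCategory : ModelCategory (D ⥤ Type (max u₁ v₁)) :=
  letI : CategoryWithFibrations (D ⥤ Type (max u₁ v₁)) :=
    ⟨(MorphismProperty.monomorphisms _ ⊓ supportEquivalences D).rlp⟩
  letI : CategoryWithCofibrations (D ⥤ Type (max u₁ v₁)) := ⟨MorphismProperty.monomorphisms _⟩
  letI : CategoryWithWeakEquivalences (D ⥤ Type (max u₁ v₁)) := ⟨supportEquivalences D⟩
  have hW : (weakEquivalences (D ⥤ Type (max u₁ v₁))).HasTwoOutOfThreeProperty :=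
    inferInstanceAs (supportEquivalences D).HasTwoOutOfThreeProperty
  have h₁ : MorphismProperty.IsWeakFactorizationSystem
      (cofibrations (D ⥤ Type (max u₁ v₁))) (trivialFibrations _) := by
    have h : trivialFibrations (D ⥤ Type (max u₁ v₁)) = (MorphismProperty.monomorphisms _).rlp :=
      rlp_inf_supportEquivalences D
    rw [h]
    exact isWeakFactorizationSystem_monomorphisms D
  have h₂ : MorphismProperty.IsWeakFactorizationSystem
      (trivialCofibrations (D ⥤ Type (max u₁ v₁))) (fibrations _) :=
    isWeakFactorizationSystem_supportEquivalences D
  ModelCategory.mk' _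

end Cofree

end FunctorToTypes

/-! ### Paths form a forest order under initial segments -/

namespace PathCat

variable {S : Type u} {k : ℕ∞}

/-- The underlying path data of an object. -/
abbrev data (P : PathCat S k) : PathData S k := P

/-- The underlying function of a morphism of paths. -/
abbrev toFun {P Q : PathCat S k} (f : P ⟶ Q) : Fin P.data.length → Fin Q.data.length :=
  f.hom.hom.toFun

/-- The root and the successor steps leave no choice, so there is at most one morphism between two
paths. -/
theorem toFun_val {P Q : PathCat S k} (f : P ⟶ Q) (i : Fin P.data.length) :
    (toFun f i : ℕ) = i := by
  obtain ⟨i, hi⟩ := i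
  induction i with
  | zero => exact congrArg Fin.val f.hom.hom.map_point
  | succ i ih =>
    have h : (toFun f ⟨i, i.lt_succ_self.trans hi⟩ : ℕ) + 1 = toFun f ⟨i + 1, hi⟩ :=
      f.hom.hom.map_acc ⟨i, i.lt_succ_self.trans hi⟩ ⟨i + 1, hi⟩ rfl
    rw [← h, ih]

instance (P Q : PathCat S k) : Subsingleton (P ⟶ Q) where
  allEq f g := by
    apply InducedCategory.hom_ext
    apply SyncTree.Hom.ext
    apply KripkeModel.Hom.ext
    funext i
    exact Fin.ext ((toFun_val f i).trans (toFun_val g i).symm)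

theorem isEmbedding {P Q : PathCat S k} (f : P ⟶ Q) : IsEmbedding f := by
  refine ⟨fun i j h => Fin.ext ?_, f.hom.isPathwiseEmbedding, fun i j h => ?_⟩
  · rw [← toFun_val f i, ← toFun_val f j]
    exact congrArg Fin.val h
  · exact (congrArg (· + 1) (toFun_val f i)).symm.trans (Eq.trans h (toFun_val f j))

theorem length_le_of_hom {P Q : PathCat S k} (f : P ⟶ Q) : P.data.length ≤ Q.data.length := by
  have hP := P.data.length_pos
  have h := (toFun f ⟨P.data.length - 1, by omega⟩).isLt
  rw [toFun_val] at h
  change P.data.length - 1 < _ at h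
  omega

/-- The initial segment with `m` elements of a path. -/
def trunc (Q : PathCat S k) (m : ℕ) (hm : 0 < m) (hmQ : m ≤ Q.data.length) : PathCat S k where
  length := m
  length_pos := hm
  length_le := le_trans (by exact_mod_cast hmQ) Q.data.length_le
  label s := {i | Fin.castLE hmQ i ∈ Q.data.label s}

/-- The inclusion of an initial segment. -/
def truncι (Q : PathCat S k) (m : ℕ) (hm : 0 < m) (hmQ : m ≤ Q.data.length) :
    trunc Q m hm hmQ ⟶ Q :=
  InducedCategory.homMk
    { hom :=
        { toFun := Fin.castLE hmQ
          map_acc := fun _ _ h => h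
          map_rel := fun _ _ h => h
          map_point := rfl }
      isPathwiseEmbedding := fun _ _ h => h }

theorem label_iff {P Q : PathCat S k} (f : P ⟶ Q) (s : S) (i : Fin P.data.length)
    (j : Fin Q.data.length) (hij : (i : ℕ) = j) : i ∈ P.data.label s ↔ j ∈ Q.data.label s := by
  obtain rfl : toFun f i = j := Fin.ext ((toFun_val f i).trans hij)
  exact ⟨f.hom.hom.map_rel s i, f.hom.isPathwiseEmbedding s i⟩

/-- A morphism of paths factors through every initial segment that is long enough. -/
def toTrunc {P Q : PathCat S k} (f : P ⟶ Q) (m : ℕ) (hm : 0 < m) (hmQ : m ≤ Q.data.length)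
    (hP : P.data.length ≤ m) : P ⟶ trunc Q m hm hmQ :=
  InducedCategory.homMk
    { hom :=
        { toFun := Fin.castLE hP
          map_acc := fun _ _ h => h
          map_rel := fun s i h => (label_iff f s i (Fin.castLE hmQ (Fin.castLE hP i)) rfl).1 h
          map_point := rfl }
      isPathwiseEmbedding := fun s i h =>
        (label_iff f s i (Fin.castLE hmQ (Fin.castLE hP i)) rfl).2 h }

/-- Equality of objects, not just isomorphism, holds in the skeleton; it allows an arrow between
paths of equal length to be replaced by an identity. -/
theorem eq_of_hom {P Q : PathCat S k} (f : P ⟶ Q) (h : P.data.length = Q.data.length) : P = Q := by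
  have hl := label_iff f
  obtain ⟨n, hn, hnk, l⟩ := P
  obtain ⟨n', hn', hnk', l'⟩ := Q
  obtain rfl : n = n' := h
  obtain rfl : l = l' := by
    funext s
    ext i
    exact hl s i i rfl
  rfl

end PathCat

/-! ### Lifting against monomorphisms by recursion on path length -/

namespace PathPresheaf

open Opposite PathCat

variable {S : Type u} {k : ℕ∞} {A B X Y : PathPresheaf S k}

/-- The elementwise form of the right lifting property against the inclusions of paths. -/
structure IsPathSurjective (f : X ⟶ Y) : Prop where
  exists_eq (P : PathCat S k) (y : Y.obj (op P)) : ∃ x, f.app (op P) x = y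
  exists_extension {P Q : PathCat S k} (i : P ⟶ Q) (x : X.obj (op P)) (y : Y.obj (op Q))
    (h : f.app (op P) x = Y.map i.op y) : ∃ z, f.app (op Q) z = y ∧ X.map i.op z = x

section Lift

variable {i : A ⟶ B} {f : X ⟶ Y} {a : A ⟶ X} {b : B ⟶ Y}

/-- Being an admissible value at `y` of a lift in a commutative square. -/
def IsLiftValue (i : A ⟶ B) (f : X ⟶ Y) (a : A ⟶ X) (b : B ⟶ Y) {P : PathCat S k}
    (y : B.obj (op P)) (x : X.obj (op P)) : Prop :=
  f.app _ x = b.app _ y ∧ ∀ z, i.app _ z = y → x = a.app _ z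

theorem exists_isLiftValue [Mono i] (hf : IsPathSurjective f) (sq : CommSq a i f b)
    {P : PathCat S k} (y : B.obj (op P)) : ∃ x, IsLiftValue i f a b y x := by
  have hi := (FunctorToTypes.mono_iff_injective i).1 inferInstance
  by_cases h : ∃ z, i.app _ z = y
  · obtain ⟨z, rfl⟩ := h
    exact ⟨a.app _ z, ConcreteCategory.congr_hom (congr_app sq.w _) z, fun z' hz => by rw [hi _ hz]⟩
  · obtain ⟨x, hx⟩ := hf.exists_eq P (b.app _ y)
    exact ⟨x, hx, fun z hz => (h ⟨z, hz⟩).elim⟩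

/-- When `y` comes from `A`, so does its restriction, and admissibility of `x` already forces it to
be the restriction of the value at `y`. Otherwise only the extension property of `f` is needed. -/
theorem exists_isLiftValue_extension [Mono i] (hf : IsPathSurjective f) (sq : CommSq a i f b)
    {P Q : PathCat S k} (g : P ⟶ Q) (y : B.obj (op Q)) (x : X.obj (op P))
    (hx : IsLiftValue i f a b (B.map g.op y) x) :
    ∃ x', IsLiftValue i f a b y x' ∧ X.map g.op x' = x := by
  have hi := (FunctorToTypes.mono_iff_injective i).1 inferInstance
  by_cases h : ∃ z, i.app _ z = y
  · obtain ⟨z, rfl⟩ := h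
    refine ⟨a.app _ z, ⟨ConcreteCategory.congr_hom (congr_app sq.w _) z, fun z' hz => by rw [hi _ hz]⟩, ?_⟩
    rw [hx.2 (A.map g.op z) (NatTrans.naturality_apply i g.op z)]
    exact (NatTrans.naturality_apply a g.op z).symm
  · obtain ⟨x', hx', hg⟩ := hf.exists_extension g x (b.app _ y)
      (hx.1.trans (NatTrans.naturality_apply b g.op y))
    exact ⟨x', ⟨hx', fun z hz => (h ⟨z, hz⟩).elim⟩, hg⟩

/-- The values of a lift, constructed by recursion on the length of paths. -/
noncomputable def liftValue [Mono i] (hf : IsPathSurjective f) (sq : CommSq a i f b) :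
    ∀ (n : ℕ) (P : PathCat S k), P.data.length = n + 1 → ∀ y : B.obj (op P),
      {x : X.obj (op P) // IsLiftValue i f a b y x}
  | 0, _, _, y => ⟨_, (exists_isLiftValue hf sq y).choose_spec⟩
  | n + 1, P, hP, y =>
    -- Extending the value already fixed on the longest proper initial segment builds in
    -- compatibility with restriction.
    let x := liftValue hf sq n (trunc P (n + 1) n.succ_pos (by omega)) rfl (B.map (truncι ..).op y)
    ⟨_, (exists_isLiftValue_extension hf sq _ y x.1 x.2).choose_spec.1⟩

theorem map_truncι_liftValue [Mono i] (hf : IsPathSurjective f) (sq : CommSq a i f b)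
    (n : ℕ) (P : PathCat S k) (hP : P.data.length = n + 1 + 1) (y : B.obj (op P)) :
    X.map (truncι P (n + 1) n.succ_pos (by omega)).op (liftValue hf sq (n + 1) P hP y).1 =
      (liftValue hf sq n (trunc P (n + 1) n.succ_pos (by omega)) rfl
        (B.map (truncι ..).op y)).1 := by
  have hm : n + 1 ≤ P.data.length := by omega
  rw [liftValue]
  exact (exists_isLiftValue_extension hf sq (truncι P (n + 1) n.succ_pos hm) y _
    (liftValue hf sq n (trunc P (n + 1) n.succ_pos hm) rfl _).2).choose_spec.2

theorem map_liftValue_of_length_eq [Mono i] (hf : IsPathSurjective f) (sq : CommSq a i f b)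
    (n m : ℕ) (P Q : PathCat S k) (hP : P.data.length = m + 1) (hQ : Q.data.length = n + 1)
    (h : P.data.length = Q.data.length) (g : P ⟶ Q) (y : B.obj (op Q)) :
    X.map g.op (liftValue hf sq n Q hQ y).1 = (liftValue hf sq m P hP (B.map g.op y)).1 := by
  obtain rfl := eq_of_hom g h
  obtain rfl : n = m := by omega
  obtain rfl : g = 𝟙 P := Subsingleton.elim _ _
  have hX : X.map (𝟙 P).op = 𝟙 _ := X.map_id _
  have hB : B.map (𝟙 P).op = 𝟙 _ := B.map_id _
  rw [hX, hB]
  rfl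

/-- An arrow into `Q` that is not an identity factors through the initial segment one shorter, where
compatibility holds by construction; induction handles the rest. -/
theorem map_liftValue [Mono i] (hf : IsPathSurjective f) (sq : CommSq a i f b)
    (n m : ℕ) (P Q : PathCat S k) (hP : P.data.length = m + 1) (hQ : Q.data.length = n + 1)
    (g : P ⟶ Q) (y : B.obj (op Q)) :
    X.map g.op (liftValue hf sq n Q hQ y).1 = (liftValue hf sq m P hP (B.map g.op y)).1 := by
  induction n generalizing Q with
  | zero =>
    have hle := length_le_of_hom g
    exact map_liftValue_of_length_eq hf sq 0 m P Q hP hQ (by have := P.data.length_pos; omega) g y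
  | succ n ih =>
    have hle := length_le_of_hom g
    by_cases h : P.data.length = Q.data.length
    · exact map_liftValue_of_length_eq hf sq (n + 1) m P Q hP hQ h g y
    · have hg : g = toTrunc g (n + 1) n.succ_pos (by omega) (by omega) ≫ truncι _ _ _ _ :=
        Subsingleton.elim _ _
      rw [hg, op_comp, Functor.map_comp, Functor.map_comp, ConcreteCategory.comp_apply,
        ConcreteCategory.comp_apply, map_truncι_liftValue]
      exact ih _ rfl _ _

theorem IsPathSurjective.hasLiftingProperty (hf : IsPathSurjective f) (i : A ⟶ B) [Mono i] :
    HasLiftingProperty i f where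
  sq_hasLift {a b} sq := by
    have hlen (P : PathCat S k) : P.data.length = P.data.length - 1 + 1 := by
      have := P.data.length_pos
      omega
    refine ⟨⟨⟨{ app := fun P => ↾fun y => (liftValue hf sq _ P.unop (hlen _) y).1
                naturality := fun P Q g => ?_ }, ?_, ?_⟩⟩⟩
    · ext y
      exact (map_liftValue hf sq _ _ _ _ (hlen _) (hlen _) g.unop y).symm
    · ext P z
      exact (liftValue hf sq _ P.unop (hlen _) (i.app P z)).2.2 z rfl
    · ext P y
      exact (liftValue hf sq _ P.unop (hlen _) y).2.1

end Lift

instance (P Q : PathCat S k) (i : P ⟶ Q) : Mono (PathCat.rep.map i) := by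
  rw [FunctorToTypes.mono_iff_injective]
  rintro R ⟨x⟩ ⟨y⟩ -
  exact congrArg ULift.up (Subsingleton.elim (α := R.unop ⟶ P) x y)

/-! ### Generating cofibrations and fibrant presheaves -/

theorem pathInclusions_le_monomorphisms (S : Type u) (k : ℕ∞) :
    pathEmbeddings S k ⊔ emptyToPath S k ≤ MorphismProperty.monomorphisms (PathPresheaf S k) := by
  rintro X Y f (hf | hf)
  · obtain ⟨i, -⟩ := hf
    exact inferInstanceAs (Mono _)
  · obtain ⟨P⟩ := hf
    refine (FunctorToTypes.mono_iff_injective (initial.to (PathCat.rep.obj P))).2 fun d x => ?_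
    -- The initial presheaf maps to its own empty subfunctor, so it has no elements.
    exact (((initial.to (⊥ : Subfunctor (⊥_ (PathPresheaf S k))).toFunctor).app d x).2).elim

theorem isPathSurjective_of_rlp (f : X ⟶ Y) (hf : (pathEmbeddings S k ⊔ emptyToPath S k).rlp f) :
    IsPathSurjective f where
  exists_eq P y := by
    have := hf _ (Or.inr (emptyToPath.mk P))
    have sq : CommSq (initial.to X) (initial.to _) f (uliftYonedaEquiv.symm y) :=
      ⟨initial.hom_ext _ _⟩
    refine ⟨uliftYonedaEquiv sq.lift, ?_⟩
    rw [← uliftYonedaEquiv_comp, sq.fac_right, Equiv.apply_symm_apply]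
  exists_extension {P Q} i x y h := by
    have := hf _ (Or.inl (pathEmbeddings.mk i (isEmbedding i)))
    have sq : CommSq (uliftYonedaEquiv.symm x) (PathCat.rep.map i) f (uliftYonedaEquiv.symm y) := by
      refine ⟨?_⟩
      rw [uliftYonedaEquiv_symm_comp, h, uliftYonedaEquiv_symm_map, Quiver.Hom.unop_op]
    refine ⟨uliftYonedaEquiv sq.lift, ?_, ?_⟩
    · rw [← uliftYonedaEquiv_comp, sq.fac_right, Equiv.apply_symm_apply]
    · rw [uliftYonedaEquiv_naturality, Quiver.Hom.unop_op]
      exact (congrArg _ sq.fac_left).trans (Equiv.apply_symm_apply _ _)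

theorem rlp_pathInclusions (S : Type u) (k : ℕ∞) :
    (pathEmbeddings S k ⊔ emptyToPath S k).rlp =
      (MorphismProperty.monomorphisms (PathPresheaf S k)).rlp := by
  refine le_antisymm (fun X Y f hf A B i hi => ?_)
    (MorphismProperty.antitone_rlp (pathInclusions_le_monomorphisms S k))
  have : Mono i := hi
  exact (isPathSurjective_of_rlp f hf).hasLiftingProperty i

/-- Sections over a path extend along inclusions of paths as soon as sections exist. -/
def ExtendsPaths (X : PathPresheaf S k) : Prop :=
  ∀ (P Q : PathCat S k) (i : P ⟶ Q), Nonempty (X.obj (op Q)) →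
    ∀ x : X.obj (op P), ∃ z, X.map i.op z = x

theorem extendsPaths_iff (X : PathPresheaf S k) :
    ExtendsPaths X ↔ ∀ (P Q : PathCat S k) (i : P ⟶ Q), PathCat.IsEmbedding i →
      Nonempty (PathCat.rep.obj Q ⟶ X) → ∀ f : PathCat.rep.obj P ⟶ X,
        ∃ g : PathCat.rep.obj Q ⟶ X, PathCat.rep.map i ≫ g = f := by
  constructor
  · intro hX P Q i _ ⟨q⟩ f
    obtain ⟨z, hz⟩ := hX P Q i ⟨uliftYonedaEquiv q⟩ (uliftYonedaEquiv f)
    refine ⟨uliftYonedaEquiv.symm z, ?_⟩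
    have h := uliftYonedaEquiv_symm_map i.op z
    rw [hz, Equiv.symm_apply_apply] at h
    exact h.symm
  · intro hX P Q i ⟨q⟩ x
    obtain ⟨g, hg⟩ := hX P Q i (isEmbedding i) ⟨uliftYonedaEquiv.symm q⟩ (uliftYonedaEquiv.symm x)
    refine ⟨uliftYonedaEquiv g, ?_⟩
    rw [uliftYonedaEquiv_naturality, Quiver.Hom.unop_op]
    exact (congrArg _ hg).trans (Equiv.apply_symm_apply _ _)

/-- Factoring `X ⟶ support X` as a monomorphism into some `Z` and a map in the right class makes `X
⟶ Z` a trivial cofibration. Hence `X` is a retract of `Z`; extensions exist in `Z` and are sent back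
by the retraction. -/
theorem extendsPaths_of_rlp (X : PathPresheaf S k) (hX : (MorphismProperty.monomorphisms
    (PathPresheaf S k) ⊓ FunctorToTypes.supportEquivalences _).rlp (terminal.from X)) :
    ExtendsPaths X := by
  intro P Q i ⟨q⟩ x
  let s := FunctorToTypes.homSupport (X := X) (Y := X) fun _ h => h
  let φ := MorphismProperty.factorizationData (MorphismProperty.monomorphisms (PathPresheaf S k))
    (MorphismProperty.monomorphisms (PathPresheaf S k)).rlp s
  have := hX φ.i ⟨φ.hi, fun d ⟨z⟩ => (φ.p.app d z).2⟩
  have sq : CommSq (𝟙 X) φ.i (terminal.from X) (terminal.from φ.Z) := ⟨terminal.hom_ext _ _⟩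
  have hp : (pathEmbeddings S k ⊔ emptyToPath S k).rlp φ.p :=
    (rlp_pathInclusions S k).ge _ φ.hp
  obtain ⟨z, -, hz⟩ := (isPathSurjective_of_rlp φ.p hp).exists_extension i (φ.i.app _ x)
    (s.app _ q) (Subsingleton.elim (α := (FunctorToTypes.support X).obj _) _ _)
  refine ⟨sq.lift.app _ z, ?_⟩
  rw [← NatTrans.naturality_apply, hz]
  exact ConcreteCategory.congr_hom (congr_app sq.fac_left (op P)) x

/-- The extension condition makes `X ⟶ support X` path-surjective, hence liftable against
monomorphisms. For a trivial cofibration `A ⟶ B`, a map `A ⟶ X` also yields the needed map `B ⟶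
support X`. -/
theorem rlp_of_extendsPaths (X : PathPresheaf S k) (hX : ExtendsPaths X) :
    (MorphismProperty.monomorphisms (PathPresheaf S k) ⊓
      FunctorToTypes.supportEquivalences _).rlp (terminal.from X) := by
  intro A B i hi
  have : Mono i := hi.1
  have hs : IsPathSurjective (FunctorToTypes.homSupport (X := X) (Y := X) fun _ h => h) :=
    { exists_eq := fun P y => ⟨y.2.some, Subsingleton.elim (α := (FunctorToTypes.support X).obj _)
        _ _⟩
      exists_extension := fun {P Q} i x y _ => by
        obtain ⟨z, hz⟩ := hX P Q i y.2 x
        exact ⟨z, Subsingleton.elim (α := (FunctorToTypes.support X).obj _) _ _, hz⟩ }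
  have := hs.hasLiftingProperty i
  refine ⟨fun {u v} _ => ?_⟩
  have sq : CommSq u i (FunctorToTypes.homSupport fun _ h => h)
      (FunctorToTypes.homSupport fun d hd => (hi.2 d hd).map (u.app d)) :=
    ⟨FunctorToTypes.hom_support_ext _ _⟩
  exact ⟨⟨⟨sq.lift, sq.fac_left, terminal.hom_ext _ _⟩⟩⟩

end PathPresheaf

theorem proposition4p1 (S : Type u) (k : ℕ∞) :
    ∃ _ : ModelCategory (PathPresheaf S k),
      (cofibrations (PathPresheaf S k) = MorphismProperty.monomorphisms (PathPresheaf S k) ∧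
        cofibrations (PathPresheaf S k) = (pathEmbeddings S k ⊔ emptyToPath S k).rlp.llp) ∧
      ∀ X : PathPresheaf S k,
        IsFibrant X ↔
          ∀ (P Q : PathCat S k) (i : P ⟶ Q), PathCat.IsEmbedding i →
            Nonempty (PathCat.rep.obj Q ⟶ X) →
              ∀ f : PathCat.rep.obj P ⟶ X,
                ∃ g : PathCat.rep.obj Q ⟶ X, PathCat.rep.map i ≫ g = f := by
  let : ModelCategory (PathPresheaf S k) := FunctorToTypes.supportModelCategory _
  refine ⟨this, ⟨rfl, ?_⟩, fun X => ?_⟩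
  · rw [PathPresheaf.rlp_pathInclusions]
    exact (FunctorToTypes.isWeakFactorizationSystem_monomorphisms (PathCat S k)ᵒᵖ).llp.symm
  · rw [← PathPresheaf.extendsPaths_iff]
    exact ⟨fun h => PathPresheaf.extendsPaths_of_rlp X h.mem,
      fun h => ⟨PathPresheaf.rlp_of_extendsPaths X h⟩⟩
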